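/- Let $I,J\ge 1$, $p=(I-1)(J-1)$, $E=\{1,\dots,p\}$, and let $\nu=(\nu_1,\dots,\nu_I)^T$ be a probability vector with positive components (the limits $\nu_i=\lim_{n\to\infty} n_i/n$ of the relative row sample sizes of an $I\times J$ table of $I$ independent multinomial samples). Consider the saturated log-linear model $\log p_{ij}=u+u_{1(i)}+\theta_{2(j)}+\theta_{12(ij)}$ with $\theta_{2(J)}=0$, $\theta_{12(iJ)}=\theta_{12(Ij)}=0$, with free parameter $\theta=(\theta_2^T,\theta_{12}^T)^T\in\mathbb{R}^{I(J-1)}$ and conditional probabilities $\pi_{ij}(\theta)=\exp(\theta_{2(j)}+\theta_{12(ij)})/\sum_{l=1}^J\exp(\theta_{2(l)}+\theta_{12(il)})$. Let $G_h$ be the $h\times h$ matrix with $1$ on the diagonal and $-1$ on the superdiagonal, let $R=(0_{p\times(J-1)},\,G_{I-1}\otimes G_{J-1})$, and let $\theta_0$ satisfy the null hypothesis $R\theta_0=0$; then all rows have the same vector of conditional probabilities $\pi(\theta_0)=(\pi_1(\theta_0),\dots,\pi_J(\theta_0))^T$. For a positive probability vector $q=(q_1,\dots,q_K)^T$ put $q^*=(q_1,\dots,q_{K-1})^T$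 and $K(q)=G_{K-1}D_{q^*}^{-1}G_{K-1}^T+\frac{1}{q_K}e_{K-1}e_{K-1}^T$, where $D_{q^*}$ is the diagonal matrix with diagonal $q^*$ and $e_{K-1}$ is the last unit vector of $\mathbb{R}^{K-1}$. Let $H=H(\theta_0)=K(\nu)\otimes K(\pi(\theta_0))$, a $p\times p$ matrix. For $0\le j\le p$ let $$w_j(\theta_0)=\sum_{S\subseteq E,\ \mathrm{card}(S)=j}\Pr(Z_1(S)\ge 0)\,\Pr(Z_2(S)\ge 0),$$ where $Z_1(S)\sim\mathcal{N}(0,H(S,S)^{-1})$, $Z_2(S)\sim\mathcal{N}\big(0,\,H(S^C,S^C)-H(S^C,S)H(S,S)^{-1}H(S^C,S)^T\big)$, and $H(A,B)$ is the submatrix of $H$ with rows in $A$ and columns in $B$ (this is the weight of $\chi^2_{p-j}$ in the asymptotic chi-bar distribution, under $R\theta=0$, of the $\phi$-divergence statistics for testing $R\theta=0$ against $R\theta\ge0$, $R\theta\neq0$). For a nonsingular covariance matrix $V$ and a closed convex cone $C\subseteq\mathbb{R}^p$ let $w_j(p,V,C)=\Pr(\Pi(Z|C)\in\mathbb{R}_+^p(j))$,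 where $Z\sim\mathcal{N}_p(0,V)$, $\Pi(Z|C)=\arg\min_{\zeta\in C}(Z-\zeta)^TV^{-1}(Z-\zeta)$, and $\mathbb{R}_+^p(j)$ is the set of vectors of $\mathbb{R}_+^p=\{\zeta\in\mathbb{R}^p:\zeta\ge0\}$ with exactly $j$ strictly positive components, the others being null. Then $H$ is positive definite; for every $z\in\mathbb{R}^p$ the function $\zeta\mapsto(z-\zeta)^TH(z-\zeta)$ has exactly one minimizer on $\mathbb{R}_+^p$; and for every $j$ and every random vector $Z\sim\mathcal{N}_p(0,H^{-1})$ $$w_j(\theta_0)=w_j\big(p,H^{-1}(\theta_0),\mathbb{R}_+^p\big)=\Pr\Big(\arg\min_{\zeta\in\mathbb{R}_+^p}(Z-\zeta)^TH(\theta_0)(Z-\zeta)\in\mathbb{R}_+^p(j)\Big).$$ Moreover $$H^{-1}(\theta_0)=K^{-1}(\nu)\otimes K^{-1}(\pi(\theta_0)),\qquad K^{-1}(q)=T_{K-1}^T\big(D_{q^*}-q^*q^{*T}\big)T_{K-1}$$ for every positive probability vector $q=(q_1,\dots,q_K)^T$, $K\ge1$, where every matrix $K(q)$ is invertible and $T_h=G_h^{-1}$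 is the upper triangular $h\times h$ matrix of ones. -/

import Mathlib

open MeasureTheory ProbabilityTheory Matrix
open scoped Kronecker

namespace LocalOdds

noncomputable section

/-! Throughout, a contingency table has `I = r + 1` rows and `J = c + 1` columns, so that
`(I - 1)(J - 1) = r * c`, and the set `E` of local odds ratios is `Fin r × Fin c`, ordered
lexicographically as in the Kronecker product. -/

/-- The `h × h` matrix with `1` on the diagonal and `-1` on the superdiagonal. -/
def G (h : ℕ) : Matrix (Fin h) (Fin h) ℝ :=
  Matrix.of fun i j => if j = i then 1 else if (j : ℕ) = (i : ℕ) + 1 then -1 else 0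

/-- The `h × h` upper triangular matrix of ones. -/
def T (h : ℕ) : Matrix (Fin h) (Fin h) ℝ :=
  Matrix.of fun i j => if i ≤ j then 1 else 0

/-- The last unit vector of `ℝ ^ h`. -/
def lastUnit (h : ℕ) : Fin h → ℝ := fun i => if (i : ℕ) + 1 = h then 1 else 0

/-- The vector `q* = (q_1, …, q_{K-1})` obtained from `q = (q_1, …, q_K)`, with `K = k + 1`. -/
def dropLast {k : ℕ} (q : Fin (k + 1) → ℝ) : Fin k → ℝ := fun i => q i.castSucc

/-- `K(q) = G D_{q*}⁻¹ Gᵀ + (1 / q_K) e eᵀ`, a `(K - 1) × (K - 1)` matrix, with `K = k + 1`. -/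
def K {k : ℕ} (q : Fin (k + 1) → ℝ) : Matrix (Fin k) (Fin k) ℝ :=
  G k * (Matrix.diagonal (dropLast q))⁻¹ * (G k)ᵀ
    + (1 / q (Fin.last k)) • Matrix.vecMulVec (lastUnit k) (lastUnit k)

/-- The parameter vector `θ = (θ_2, θ_12)` of the saturated log-linear model
`log p_ij = u + u_1(i) + θ_2(j) + θ_12(ij)`, without the components that are fixed to `0`. -/
abbrev Param (r c : ℕ) : Type := Fin c ⊕ (Fin r × Fin c) → ℝ

/-- `θ_2(j)` for all `J` columns, with `θ_2(J) = 0`. -/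
def theta2 {r c : ℕ} (θ : Param r c) : Fin (c + 1) → ℝ :=
  Fin.snoc (α := fun _ => ℝ) (fun j => θ (Sum.inl j)) 0

/-- `θ_12(ij)` for all `I` rows and `J` columns, with `θ_12(iJ) = 0` and `θ_12(Ij) = 0`. -/
def theta12 {r c : ℕ} (θ : Param r c) : Fin (r + 1) → Fin (c + 1) → ℝ :=
  Fin.snoc (α := fun _ => Fin (c + 1) → ℝ)
    (fun i => Fin.snoc (α := fun _ => ℝ) (fun j => θ (Sum.inr (i, j))) 0) 0

/-- `π_ij(θ) = Pr(Y = j | X = i)`. The parameters `u` and `u_1(i)` of the model do not depend on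
`j` and are determined by the row totals, so they cancel. -/
def condProb {r c : ℕ} (θ : Param r c) (i : Fin (r + 1)) (j : Fin (c + 1)) : ℝ :=
  Real.exp (theta2 θ j + theta12 θ i j) / ∑ l, Real.exp (theta2 θ l + theta12 θ i l)

/-- The restriction matrix `R = (0, G_{I-1} ⊗ G_{J-1})`. -/
def R (r c : ℕ) : Matrix (Fin r × Fin c) (Fin c ⊕ (Fin r × Fin c)) ℝ :=
  Matrix.fromCols 0 (G r ⊗ₖ G c)

/-- The null hypothesis `R θ = 0`: all the local odds ratios are equal to `1`. -/
def IsNull {r c : ℕ} (θ : Param r c) : Prop := R r c *ᵥ θ = 0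

/-- `π(θ)`, the vector of conditional probabilities of the columns that is common to all the rows
when `θ` satisfies the null hypothesis (see `condProb_eq_commonProb`); it is read off the last
row. -/
def commonProb {r c : ℕ} (θ : Param r c) : Fin (c + 1) → ℝ := condProb θ (Fin.last r)

theorem det_G (h : ℕ) : (G h).det = 1 := by
  rw [Matrix.det_of_isUpperTriangular]
  · simp [G]
  · intro i j hij
    have hlt : (j : ℕ) < (i : ℕ) := hij
    have h1 : j ≠ i := fun e => by simp [e] at hlt
    have h2 : (j : ℕ) ≠ (i : ℕ) + 1 := by omega
    simp [G, h1, h2]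

/-- Under the null hypothesis all the rows have the same conditional distribution. -/
theorem condProb_eq_commonProb {r c : ℕ} {θ : Param r c} (hθ : IsNull θ) (i : Fin (r + 1)) :
    condProb θ i = commonProb θ := by
  have hG : (G r ⊗ₖ G c) *ᵥ (fun x => θ (Sum.inr x)) = 0 := by
    have h := hθ
    rw [IsNull, R, Matrix.fromCols_mulVec, Matrix.zero_mulVec, zero_add] at h
    exact h
  have hz : (fun x => θ (Sum.inr x)) = 0 := by
    refine Matrix.eq_zero_of_mulVec_eq_zero ?_ hG
    rw [Matrix.det_kronecker, det_G, det_G]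
    simp
  have h12 : theta12 θ = 0 := by
    funext a b
    refine Fin.lastCases ?_ (fun a => ?_) a
    · simp [theta12]
    · refine Fin.lastCases ?_ (fun b => ?_) b
      · simp [theta12]
      · simpa [theta12] using congrFun hz (a, b)
  funext j
  simp [commonProb, condProb, h12]

/-- `H(θ) = K(ν) ⊗ K(π(θ))`. -/
def H {r c : ℕ} (ν : Fin (r + 1) → ℝ) (θ : Param r c) :
    Matrix (Fin r × Fin c) (Fin r × Fin c) ℝ :=
  K ν ⊗ₖ K (commonProb θ)

/-- The nonnegative orthant. -/
def orthant (ι : Type*) : Set (EuclideanSpace ℝ ι) := {x | ∀ i, 0 ≤ x i}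

/-- The points of the nonnegative orthant with exactly `j` strictly positive components (the other
components are then null). -/
def orthantFace (ι : Type*) [Fintype ι] (j : ℕ) : Set (EuclideanSpace ℝ ι) :=
  {x | x ∈ orthant ι ∧ Nat.card {i // 0 < x i} = j}

/-- The submatrix of `M` with row indices in `A` and column indices in `B`. -/
def sub {ι : Type*} (M : Matrix ι ι ℝ) (A B : Finset ι) : Matrix A B ℝ :=
  M.submatrix Subtype.val Subtype.val

/-- `Σ_1(S) = H(S, S)⁻¹`. -/
def sigma1 {ι : Type*} [DecidableEq ι] (M : Matrix ι ι ℝ) (S : Finset ι) : Matrix S S ℝ :=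
  (sub M S S)⁻¹

/-- `Σ_2(S) = H(Sᶜ, Sᶜ) - H(Sᶜ, S) H(S, S)⁻¹ H(Sᶜ, S)ᵀ`. -/
def sigma2 {ι : Type*} [Fintype ι] [DecidableEq ι] (M : Matrix ι ι ℝ) (S : Finset ι) :
    Matrix (Sᶜ : Finset ι) (Sᶜ : Finset ι) ℝ :=
  sub M Sᶜ Sᶜ - sub M Sᶜ S * (sub M S S)⁻¹ * (sub M Sᶜ S)ᵀ

/-- The weight `w_h(θ) = ∑_{card S = h} Pr(Z_1(S) ≥ 0) Pr(Z_2(S) ≥ 0)` of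
`χ²_{(I-1)(J-1)-h}` in the asymptotic chi-bar distribution of the test statistics, where
`Z_1(S) ∼ N(0, Σ_1(S))`, `Z_2(S) ∼ N(0, Σ_2(S))`. -/
def testWeight {r c : ℕ} (ν : Fin (r + 1) → ℝ) (θ : Param r c) (h : ℕ) : ℝ :=
  ∑ S ∈ (Finset.univ : Finset (Fin r × Fin c)).powersetCard h,
    (multivariateGaussian 0 (sigma1 (H ν θ) S)).real (orthant S)
      * (multivariateGaussian 0 (sigma2 (H ν θ) S)).real (orthant (Sᶜ : Finset (Fin r × Fin c)))

/-- The quadratic form `xᵀ M x`. -/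
def quad {ι : Type*} [Fintype ι] (M : Matrix ι ι ℝ) (x : EuclideanSpace ℝ ι) : ℝ :=
  x.ofLp ⬝ᵥ (M *ᵥ x.ofLp)

/-- The set `arg min_{ζ ∈ C} (z - ζ)ᵀ M (z - ζ)`. -/
def argmin {ι : Type*} [Fintype ι] (M : Matrix ι ι ℝ) (C : Set (EuclideanSpace ℝ ι))
    (z : EuclideanSpace ℝ ι) : Set (EuclideanSpace ℝ ι) :=
  {ζ | ζ ∈ C ∧ ∀ ξ ∈ C, quad M (z - ζ) ≤ quad M (z - ξ)}

/-- The chi-bar weight `w_j(p, V, C) = Pr(Π(Z | C) ∈ ℝ_+^p(j))`, where `Z ∼ N_p(0, V)` with `V`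
nonsingular, `C` is a closed convex cone and `Π(Z | C)` is the point of `C` that minimizes
`(Z - ζ)ᵀ V⁻¹ (Z - ζ)`. -/
def chiBarWeight {ι : Type*} [Fintype ι] [DecidableEq ι] (V : Matrix ι ι ℝ)
    (C : Set (EuclideanSpace ℝ ι)) (j : ℕ) : ℝ :=
  (multivariateGaussian 0 V).real {z | ∃ ζ ∈ argmin V⁻¹ C z, ζ ∈ orthantFace ι j}

end

end LocalOdds

namespace LocalOdds

/-! ### The explicit inverses -/

/-! Write M for H, P and Q for the inclusions of the coordinates in S and in its complement. By the
Karush–Kuhn–Tucker conditions (`mem_argmin_orthant_iff`), z projects to a point with support exactly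
S iff z = P a - M⁻¹ Q b with a > 0 and b ≥ 0: a is the positive part of the projection and b the
gradient off S (`unproj_mem_projFace_iff`). If a and b are independent centred Gaussians with
covariances Σ₁(S) and Σ₂(S), then z has covariance M⁻¹, by a Schur complement identity
(`inv_eq_sigma`). Hence the probability of each face is the product of two orthant probabilities.
The faces are disjoint because the projection is unique, and summing over card S = j gives the
weight. The inverse of K(q) is separate: since G maps the all-ones vector to the last unit vector,
K(q) = G (D⁻¹ + 11ᵀ/q_K) Gᵀ, and Sherman–Morrison inverts the middle factor. -/

theorem G_mul_T (h : ℕ) : G h * T h = 1 := by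
  ext i j
  -- Only k = i and k = i + 1 contribute. The second condition i + 1 ≤ j is written i < j, which
  -- fails by itself in the last row, where i + 1 is not an index.
  have key : ∀ k : Fin h, G h i k * T h k j =
      (if k = i then (if i ≤ j then (1 : ℝ) else 0) else 0)
        - (if (k : ℕ) = (i : ℕ) + 1 then (if i < j then (1 : ℝ) else 0) else 0) := by
    intro k
    simp only [G, T, Matrix.of_apply, Fin.le_def, Fin.lt_def, Fin.ext_iff]
    split_ifs <;> first | omega | simp
  rw [Matrix.mul_apply, Finset.sum_congr rfl fun k _ => key k, Finset.sum_sub_distrib,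
    Finset.sum_ite_eq' Finset.univ i, if_pos (Finset.mem_univ i)]
  have hs : ∑ k : Fin h, (if (k : ℕ) = (i : ℕ) + 1 then (if i < j then (1 : ℝ) else 0) else 0)
      = if i < j then 1 else 0 := by
    by_cases hij : i < j
    · have hh : (i : ℕ) + 1 < h := lt_of_le_of_lt (Fin.lt_def.1 hij) j.2
      rw [Finset.sum_eq_single (⟨(i : ℕ) + 1, hh⟩ : Fin h)]
      · simp
      · intro k _ hk
        rw [if_neg]
        exact fun e => hk (Fin.ext e)
      · simp
    · simp [hij]
  rw [hs, Matrix.one_apply]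
  rcases lt_trichotomy i j with hij | hij | hij
  · simp [hij, hij.le, hij.ne]
  · simp [hij]
  · simp [hij.not_ge, hij.not_gt, hij.ne']

theorem T_eq_inv_G (h : ℕ) : T h = (G h)⁻¹ := (Matrix.inv_eq_right_inv (G_mul_T h)).symm

theorem isUnit_det_G (h : ℕ) : IsUnit (G h).det := by simp [det_G]

theorem T_mulVec_lastUnit (h : ℕ) : T h *ᵥ lastUnit h = fun _ => 1 := by
  ext i
  have hh : h - 1 < h := by have := i.2; omega
  simp only [Matrix.mulVec, dotProduct]
  rw [Finset.sum_eq_single (⟨h - 1, hh⟩ : Fin h)]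
  · have h1 : i ≤ ⟨h - 1, hh⟩ := by rw [Fin.le_def]; have := i.2; simp only; omega
    have h2 : h - 1 + 1 = h := by omega
    simp [T, lastUnit, h1, h2]
  · intro k _ hk
    have : (k : ℕ) + 1 ≠ h := fun e => hk (Fin.ext (by simp only; omega))
    simp [lastUnit, this]
  · simp

theorem G_mulVec_one (h : ℕ) : (G h *ᵥ fun _ => (1 : ℝ)) = lastUnit h := by
  rw [← T_mulVec_lastUnit, Matrix.mulVec_mulVec, G_mul_T, Matrix.one_mulVec]

theorem K_eq {k : ℕ} (q : Fin (k + 1) → ℝ) :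
    K q = G k * ((Matrix.diagonal (dropLast q))⁻¹
      + (1 / q (Fin.last k)) • Matrix.vecMulVec (fun _ => 1) (fun _ => 1)) * (G k)ᵀ := by
  rw [K, ← G_mulVec_one, mul_add, add_mul, Matrix.mul_smul, Matrix.smul_mul,
    Matrix.mul_vecMulVec, Matrix.vecMulVec_mul, Matrix.vecMul_transpose]

/-- Sherman–Morrison: the rank-one terms cancel because the entries of q* sum to 1 - q_K. -/
theorem inner_mul_inv {k : ℕ} {q : Fin (k + 1) → ℝ} (hq : ∀ i, 0 < q i) (hs : ∑ i, q i = 1) :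
    ((Matrix.diagonal (dropLast q))⁻¹
      + (1 / q (Fin.last k)) • Matrix.vecMulVec (fun _ => (1 : ℝ)) (fun _ => 1))
      * (Matrix.diagonal (dropLast q) - Matrix.vecMulVec (dropLast q) (dropLast q)) = 1 := by
  have hd : IsUnit (Matrix.diagonal (dropLast q)).det := by
    rw [Matrix.det_diagonal, isUnit_iff_ne_zero]
    exact Finset.prod_ne_zero_iff.2 fun i _ => (hq _).ne'
  have h1 : (Matrix.diagonal (dropLast q))⁻¹ *ᵥ dropLast q = fun _ => 1 := by
    have : dropLast q = Matrix.diagonal (dropLast q) *ᵥ fun _ => 1 := by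
      ext i; simp [Matrix.mulVec_diagonal]
    nth_rw 2 [this]
    rw [Matrix.mulVec_mulVec, Matrix.nonsing_inv_mul _ hd, Matrix.one_mulVec]
  have h2 : (fun _ => (1 : ℝ)) ᵥ* Matrix.diagonal (dropLast q) = dropLast q := by
    ext i; simp [Matrix.vecMul_diagonal]
  have h3 : (fun _ => (1 : ℝ)) ⬝ᵥ dropLast q = 1 - q (Fin.last k) := by
    rw [Fin.sum_univ_castSucc] at hs
    simp only [dotProduct, dropLast, one_mul]
    linarith
  rw [add_mul, mul_sub, Matrix.nonsing_inv_mul _ hd, Matrix.mul_vecMulVec, h1, Matrix.smul_mul,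
    mul_sub, Matrix.vecMulVec_mul, h2, Matrix.vecMulVec_mul_vecMulVec, h3]
  have hK := (hq (Fin.last k)).ne'
  ext i j
  simp [Matrix.vecMulVec_apply]
  field_simp
  ring

theorem K_mul_inv {k : ℕ} {q : Fin (k + 1) → ℝ} (hq : ∀ i, 0 < q i) (hs : ∑ i, q i = 1) :
    K q * ((T k)ᵀ * (Matrix.diagonal (dropLast q)
      - Matrix.vecMulVec (dropLast q) (dropLast q)) * T k) = 1 := by
  have h1 : (G k)ᵀ * (T k)ᵀ = 1 := by
    rw [← Matrix.transpose_mul, mul_eq_one_comm.1 (G_mul_T k), Matrix.transpose_one]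
  rw [K_eq]
  calc _ = G k * (((Matrix.diagonal (dropLast q))⁻¹
      + (1 / q (Fin.last k)) • Matrix.vecMulVec (fun _ => 1) (fun _ => 1)) * ((G k)ᵀ * (T k)ᵀ)
      * (Matrix.diagonal (dropLast q) - Matrix.vecMulVec (dropLast q) (dropLast q))) * T k := by
        simp only [Matrix.mul_assoc]
    _ = 1 := by rw [h1, Matrix.mul_one, inner_mul_inv hq hs, Matrix.mul_one, G_mul_T]

theorem isUnit_det_K {k : ℕ} {q : Fin (k + 1) → ℝ} (hq : ∀ i, 0 < q i) (hs : ∑ i, q i = 1) :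
    IsUnit (K q).det := Matrix.isUnit_det_of_right_inverse (K_mul_inv hq hs)

theorem K_inv {k : ℕ} {q : Fin (k + 1) → ℝ} (hq : ∀ i, 0 < q i) (hs : ∑ i, q i = 1) :
    (K q)⁻¹ = (T k)ᵀ * (Matrix.diagonal (dropLast q)
      - Matrix.vecMulVec (dropLast q) (dropLast q)) * T k :=
  Matrix.inv_eq_right_inv (K_mul_inv hq hs)

theorem posDef_K {k : ℕ} {q : Fin (k + 1) → ℝ} (hq : ∀ i, 0 < q i) : (K q).PosDef := by
  refine Matrix.PosDef.add_posSemidef ?_ ?_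
  · have hd : (Matrix.diagonal (dropLast q))⁻¹.PosDef :=
      (Matrix.PosDef.diagonal fun i => hq _).inv
    have := hd.mul_mul_conjTranspose_same (B := G k)
      (Matrix.vecMul_injective_iff_isUnit.2 ((Matrix.isUnit_iff_isUnit_det _).2 (isUnit_det_G k)))
    rwa [Matrix.conjTranspose_eq_transpose_of_trivial] at this
  · refine Matrix.PosSemidef.smul ?_ (one_div_nonneg.2 (hq _).le)
    simpa using Matrix.posSemidef_vecMulVec_self_star (lastUnit k)

theorem commonProb_pos {r c : ℕ} (θ : Param r c) (j : Fin (c + 1)) : 0 < commonProb θ j :=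
  div_pos (Real.exp_pos _) (Finset.sum_pos (fun _ _ => Real.exp_pos _) Finset.univ_nonempty)

theorem posDef_H {r c : ℕ} {ν : Fin (r + 1) → ℝ} (hν : ∀ i, 0 < ν i) (θ : Param r c) :
    (H ν θ).PosDef :=
  (posDef_K hν).kronecker (posDef_K (commonProb_pos θ))

/-! ### Minimizers of a quadratic form on the orthant -/

theorem isClosed_orthant {ι : Type*} : IsClosed (orthant ι) := by
  have : orthant ι = ⋂ i, {x : EuclideanSpace ℝ ι | 0 ≤ x i} := by ext; simp [orthant]
  rw [this]
  exact isClosed_iInter fun i => isClosed_le continuous_const (by fun_prop)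

section Argmin

variable {ι : Type*} [Fintype ι]

/-- Exact second-order Taylor expansion of the objective at ζ, where its gradient is 2 M (ζ - z). -/
theorem quad_sub {M : Matrix ι ι ℝ} (hM : M.IsHermitian) (z ζ ξ : EuclideanSpace ℝ ι) :
    quad M (z - ξ) = quad M (z - ζ)
      + 2 * ((M *ᵥ (ζ.ofLp - z.ofLp)) ⬝ᵥ (ξ.ofLp - ζ.ofLp)) + quad M (ξ - ζ) := by
  have hsymm : ∀ x y : ι → ℝ, x ⬝ᵥ (M *ᵥ y) = y ⬝ᵥ (M *ᵥ x) := fun x y => by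
    rw [Matrix.dotProduct_mulVec, ← Matrix.mulVec_transpose,
      ← Matrix.conjTranspose_eq_transpose_of_trivial, hM.eq, dotProduct_comm]
  rw [dotProduct_comm]
  simp only [quad, WithLp.ofLp_sub, Matrix.mulVec_sub, sub_dotProduct, dotProduct_sub]
  rw [hsymm z.ofLp ξ.ofLp, hsymm z.ofLp ζ.ofLp, hsymm ζ.ofLp ξ.ofLp]
  ring

theorem quad_pos {M : Matrix ι ι ℝ} (hM : M.PosDef) {x : EuclideanSpace ℝ ι} (hx : x ≠ 0) :
    0 < quad M x := by
  have := hM.dotProduct_mulVec_pos (x := x.ofLp) (by simpa using hx)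
  simpa [quad] using this

theorem quad_nonneg {M : Matrix ι ι ℝ} (hM : M.PosDef) (x : EuclideanSpace ℝ ι) :
    0 ≤ quad M x := by
  have := hM.posSemidef.dotProduct_mulVec_nonneg x.ofLp
  simpa [quad] using this

/-- The Karush–Kuhn–Tucker conditions. -/
theorem mem_argmin_orthant_iff [DecidableEq ι] {M : Matrix ι ι ℝ} (hM : M.PosDef)
    {z ζ : EuclideanSpace ℝ ι} :
    ζ ∈ argmin M (orthant ι) z ↔ ζ ∈ orthant ι ∧
      (∀ i, 0 ≤ (M *ᵥ (ζ.ofLp - z.ofLp)) i) ∧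
      ∀ i, 0 < ζ i → (M *ᵥ (ζ.ofLp - z.ofLp)) i = 0 := by
  set g := M *ᵥ (ζ.ofLp - z.ofLp) with hg
  constructor
  · rintro ⟨h0, hmin⟩
    -- Compare ζ with its perturbation by t along one coordinate; the bound on t keeps it in the
    -- orthant.
    have step : ∀ (i : ι) (t : ℝ), -ζ i ≤ t → 0 ≤ 2 * (g i * t) + t * t * M i i := by
      intro i t ht
      have hmem : ζ + WithLp.toLp 2 (Pi.single i t) ∈ orthant ι := by
        intro k
        by_cases hk : k = i
        · subst hk; simp; linarith
        · simpa [hk] using h0 k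
      have h1 := hmin _ hmem
      rw [quad_sub hM.isHermitian z ζ (ζ + _), ← hg] at h1
      have h2 : (ζ + WithLp.toLp 2 (Pi.single i t)).ofLp - ζ.ofLp = Pi.single i t := by
        ext; simp
      rw [h2, add_sub_cancel_left] at h1
      simp only [quad, dotProduct_single, single_dotProduct, Matrix.mulVec_single] at h1
      simp at h1
      linarith
    have hpos : ∀ i, 0 < M i i := fun i => hM.diag_pos
    have hnn : ∀ i, 0 ≤ g i := by
      intro i
      by_contra! hneg
      -- This t minimizes the one-variable quadratic; it is positive when g i < 0, hence admissible.
      have h1 := step i (-g i / M i i)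
        (le_trans (neg_nonpos.2 (h0 i)) (div_nonneg (by linarith) (hpos i).le))
      have h2 : 2 * (g i * (-g i / M i i)) + -g i / M i i * (-g i / M i i) * M i i
          = -(g i * g i / M i i) := by
        have := (hpos i).ne'
        field_simp
        ring
      have h3 : 0 < g i * g i / M i i := div_pos (mul_pos_of_neg_of_neg hneg hneg) (hpos i)
      linarith
    refine ⟨h0, hnn, fun i hi => ?_⟩
    by_contra hne
    have hgi : 0 < g i := lt_of_le_of_ne (hnn i) (Ne.symm hne)
    -- A step down by s is truncated at ζ i to stay feasible; it changes the objective by at most -g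
    -- i * s < 0.
    set s := min (ζ i) (g i / M i i) with hs
    have hs0 : 0 < s := lt_min hi (div_pos hgi (hpos i))
    have h1 := step i (-s) (neg_le_neg (min_le_left _ _))
    have h2 : s * M i i ≤ g i := (le_div_iff₀ (hpos i)).1 (min_le_right _ _)
    nlinarith
  · rintro ⟨h0, hnn, hc⟩
    refine ⟨h0, fun ξ hξ => ?_⟩
    rw [quad_sub hM.isHermitian z ζ ξ, ← hg]
    have h1 : 0 ≤ g ⬝ᵥ (ξ.ofLp - ζ.ofLp) := by
      refine Finset.sum_nonneg fun i _ => ?_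
      rcases (h0 i).eq_or_lt with hi | hi
      · simpa [← hi] using mul_nonneg (hnn i) (hξ i)
      · simp [hc i hi]
    linarith [quad_nonneg hM (ξ - ζ)]

theorem argmin_orthant_unique [DecidableEq ι] {M : Matrix ι ι ℝ} (hM : M.PosDef)
    {z ζ ξ : EuclideanSpace ℝ ι} (hζ : ζ ∈ argmin M (orthant ι) z)
    (hξ : ξ ∈ argmin M (orthant ι) z) : ξ = ζ := by
  by_contra hne
  have h1 := hξ.2 ζ hζ.1
  rw [quad_sub hM.isHermitian z ζ ξ] at h1
  obtain ⟨h0, hnn, hc⟩ := (mem_argmin_orthant_iff hM).1 hζ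
  have h2 : 0 ≤ (M *ᵥ (ζ.ofLp - z.ofLp)) ⬝ᵥ (ξ.ofLp - ζ.ofLp) := by
    refine Finset.sum_nonneg fun i _ => ?_
    rcases (h0 i).eq_or_lt with hi | hi
    · simpa [← hi] using mul_nonneg (hnn i) (hξ.1 i)
    · simp [hc i hi]
  linarith [quad_pos hM (sub_ne_zero.2 hne)]

open scoped MatrixOrder in
-- Factoring M = BᵀB with B injective turns the problem into finding a Euclidean nearest point in
-- the closed set B(orthant).
theorem exists_mem_argmin_orthant [DecidableEq ι] {M : Matrix ι ι ℝ} (hM : M.PosDef)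
    (z : EuclideanSpace ℝ ι) : ∃ ζ, ζ ∈ argmin M (orthant ι) z := by
  obtain ⟨B, rfl⟩ := CStarAlgebra.nonneg_iff_eq_star_mul_self.1 hM.posSemidef.nonneg
  have hnorm : ∀ x, quad (star B * B) x = ‖Matrix.toEuclideanLin B x‖ ^ 2 := fun x => by
    rw [EuclideanSpace.real_norm_sq_eq, quad, ← Matrix.mulVec_mulVec, Matrix.dotProduct_mulVec,
      Matrix.star_eq_conjTranspose, Matrix.conjTranspose_eq_transpose_of_trivial,
      Matrix.vecMul_transpose]
    simp [dotProduct, pow_two]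
  have hinj : Function.Injective (Matrix.toEuclideanLin B) := by
    refine (injective_iff_map_eq_zero _).2 fun x hx => ?_
    by_contra hne
    have := quad_pos hM hne
    rw [hnorm, hx] at this
    simp at this
  let e : EuclideanSpace ℝ ι ≃L[ℝ] EuclideanSpace ℝ ι :=
    (LinearEquiv.ofInjectiveEndo _ hinj).toContinuousLinearEquiv
  have he : ∀ x, quad (star B * B) x = ‖e x‖ ^ 2 := hnorm
  have hcl : IsClosed (e '' orthant ι) := e.toHomeomorph.isClosedMap _ isClosed_orthant
  obtain ⟨_, ⟨ζ, hζ, rfl⟩, hd⟩ := hcl.exists_infDist_eq_dist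
    (Set.Nonempty.image e ⟨0, fun i => by simp⟩) (e z)
  refine ⟨ζ, hζ, fun ξ hξ => ?_⟩
  have h1 : dist (e z) (e ζ) ≤ dist (e z) (e ξ) :=
    hd ▸ Metric.infDist_le_dist_of_mem (Set.mem_image_of_mem e hξ)
  rw [he, he, map_sub, map_sub, ← dist_eq_norm, ← dist_eq_norm]
  gcongr

end Argmin
end LocalOdds
namespace LocalOdds

/-! ### Gaussian measures -/

section Gaussian

open scoped RealInnerProductSpace

variable {ι α β : Type*} [Fintype ι] [DecidableEq ι] [Fintype α] [DecidableEq α]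
  [Fintype β] [DecidableEq β]

omit [Fintype ι] [DecidableEq ι] in
theorem ofLp_toEuclideanLin (A : Matrix ι α ℝ) (x : EuclideanSpace ℝ α) :
    (Matrix.toEuclideanLin A x).ofLp = A *ᵥ x.ofLp := rfl

theorem inner_toEuclideanLin_left (A : Matrix ι α ℝ) (x : EuclideanSpace ℝ α)
    (t : EuclideanSpace ℝ ι) :
    ⟪Matrix.toEuclideanLin A x, t⟫ = ⟪x, Matrix.toEuclideanLin Aᵀ t⟫ := by
  simp only [EuclideanSpace.inner_eq_star_dotProduct, star_trivial, ofLp_toEuclideanLin]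
  rw [Matrix.dotProduct_mulVec, Matrix.mulVec_transpose]

theorem dotProduct_mul_mul_transpose_mulVec {ι α : Type*} [Fintype ι] [Fintype α]
    (A : Matrix ι α ℝ) (S : Matrix α α ℝ) (t : ι → ℝ) :
    t ⬝ᵥ ((A * S * Aᵀ) *ᵥ t) = (Aᵀ *ᵥ t) ⬝ᵥ (S *ᵥ (Aᵀ *ᵥ t)) := by
  rw [← Matrix.mulVec_mulVec, ← Matrix.mulVec_mulVec, Matrix.dotProduct_mulVec,
    ← Matrix.mulVec_transpose]

/-- A linear image of a pair of independent centred Gaussian vectors is Gaussian. -/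
theorem map_prod_multivariateGaussian {S₁ : Matrix α α ℝ} {S₂ : Matrix β β ℝ}
    (h₁ : S₁.PosSemidef) (h₂ : S₂.PosSemidef) (A : Matrix ι α ℝ) (B : Matrix ι β ℝ) :
    ((multivariateGaussian 0 S₁).prod (multivariateGaussian 0 S₂)).map
        (fun x => Matrix.toEuclideanLin A x.1 + Matrix.toEuclideanLin B x.2)
      = multivariateGaussian 0 (A * S₁ * Aᵀ + B * S₂ * Bᵀ) := by
  have hcA : Continuous (Matrix.toEuclideanLin A) := LinearMap.continuous_of_finiteDimensional _
  have hcB : Continuous (Matrix.toEuclideanLin B) := LinearMap.continuous_of_finiteDimensional _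
  have hmeas : Measurable (fun x : EuclideanSpace ℝ α × EuclideanSpace ℝ β =>
      Matrix.toEuclideanLin A x.1 + Matrix.toEuclideanLin B x.2) := by fun_prop
  have hS : (A * S₁ * Aᵀ + B * S₂ * Bᵀ).PosSemidef := by
    have hA := h₁.mul_mul_conjTranspose_same A
    have hB := h₂.mul_mul_conjTranspose_same B
    rw [Matrix.conjTranspose_eq_transpose_of_trivial] at hA hB
    exact hA.add hB
  have : IsProbabilityMeasure (((multivariateGaussian 0 S₁).prod (multivariateGaussian 0 S₂)).map
      (fun x => Matrix.toEuclideanLin A x.1 + Matrix.toEuclideanLin B x.2)) :=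
    Measure.isProbabilityMeasure_map hmeas.aemeasurable
  refine Measure.ext_of_charFun (funext fun t => ?_)
  rw [charFun_multivariateGaussian hS, charFun_apply, integral_map hmeas.aemeasurable
    (Measurable.aestronglyMeasurable (by fun_prop))]
  -- Moving A and B to the other side of the inner product splits the integrand into a function of
  -- x.1 times a function of x.2.
  simp only [inner_add_left, inner_toEuclideanLin_left, Complex.ofReal_add, add_mul, Complex.exp_add]
  rw [integral_prod_mul (fun x => Complex.exp (⟪x, Matrix.toEuclideanLin Aᵀ t⟫ * Complex.I))
    (fun x => Complex.exp (⟪x, Matrix.toEuclideanLin Bᵀ t⟫ * Complex.I)),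
    ← charFun_apply, ← charFun_apply, charFun_multivariateGaussian h₁,
    charFun_multivariateGaussian h₂, ← Complex.exp_add]
  simp only [inner_zero_right, ofLp_toEuclideanLin, Matrix.add_mulVec,
    dotProduct_add, dotProduct_mul_mul_transpose_mulVec]
  push_cast
  congr 1
  ring

/-- The boundary of the orthant is a null set for a nondegenerate Gaussian measure. -/
theorem multivariateGaussian_real_orthant {S : Matrix ι ι ℝ} (hS : S.PosDef) :
    (multivariateGaussian 0 S).real {x | ∀ i, 0 < x i}
      = (multivariateGaussian 0 S).real (orthant ι) := by
  refine measureReal_congr ?_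
  have h : ∀ i, ∀ᵐ x ∂(multivariateGaussian 0 S), x i ≠ 0 := by
    intro i
    -- Each coordinate is a real Gaussian of positive variance, so it has no atom at 0.
    have hmp := measurePreserving_eval_multivariateGaussian (μ := 0) hS.posSemidef (i := i)
    have hna : NullSingletonClass (gaussianReal ((0 : EuclideanSpace ℝ ι) i) (S i i).toNNReal) :=
      nullSingletonClass_gaussianReal (by simpa using hS.diag_pos)
    have h0 := hmp.measure_preimage (measurableSet_singleton (0 : ℝ)).nullMeasurableSet
    rw [measure_singleton] at h0
    exact measure_eq_zero_iff_ae_notMem.1 h0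
  filter_upwards [ae_all_iff.2 h] with x hx
  exact propext (forall_congr' fun i => ⟨le_of_lt, fun hi => lt_of_le_of_ne hi (hx i).symm⟩)

end Gaussian

/-! ### The faces of the orthant -/

section Faces

variable {ι : Type*} [Fintype ι] [DecidableEq ι]

/-- The inclusion of the coordinates in `A`. -/
def incl (A : Finset ι) : Matrix ι A ℝ := (1 : Matrix ι ι ℝ).submatrix id Subtype.val

/-- Lets block computations be carried out as products of matrices. -/
theorem sub_eq_incl (M : Matrix ι ι ℝ) (A B : Finset ι) :
    sub M A B = (incl A)ᵀ * M * incl B := by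
  ext i j
  simp [sub, incl, Matrix.mul_apply, Matrix.one_apply]

theorem incl_transpose_mulVec (A : Finset ι) (x : ι → ℝ) :
    (incl A)ᵀ *ᵥ x = fun i : A => x i := by
  ext i
  simp [incl, Matrix.mulVec, dotProduct, Matrix.one_apply]

omit [Fintype ι] in
theorem incl_mulVec_mem {A : Finset ι} (x : A → ℝ) {i : ι} (hi : i ∈ A) :
    (incl A *ᵥ x) i = x ⟨i, hi⟩ := by
  simp only [incl, Matrix.mulVec, dotProduct, Matrix.submatrix_apply, id, Matrix.one_apply]
  rw [Finset.sum_eq_single ⟨i, hi⟩]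
  · simp
  · intro b _ hb
    rw [if_neg, zero_mul]
    exact fun e => hb (Subtype.ext e.symm)
  · simp

omit [Fintype ι] in
theorem incl_mulVec_notMem {A : Finset ι} (x : A → ℝ) {i : ι} (hi : i ∉ A) :
    (incl A *ᵥ x) i = 0 := by
  simp only [incl, Matrix.mulVec, dotProduct, Matrix.submatrix_apply, id, Matrix.one_apply]
  refine Finset.sum_eq_zero fun b _ => ?_
  rw [if_neg, zero_mul]
  rintro rfl
  exact hi b.2

theorem incl_transpose_mul_incl (A : Finset ι) : (incl A)ᵀ * incl A = 1 := by
  have h := sub_eq_incl 1 A A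
  rw [Matrix.mul_one] at h
  exact h.symm.trans (Matrix.submatrix_one _ Subtype.val_injective)

theorem incl_compl_transpose_mul_incl (A : Finset ι) : (incl Aᶜ)ᵀ * incl A = 0 := by
  have h := sub_eq_incl 1 Aᶜ A
  rw [Matrix.mul_one] at h
  rw [← h]
  ext i j
  exact Matrix.one_apply_ne fun e => Finset.mem_compl.1 i.2 (e ▸ j.2)

theorem incl_mul_add_incl_compl_mul (A : Finset ι) :
    incl A * (incl A)ᵀ + incl Aᶜ * (incl Aᶜ)ᵀ = 1 := by
  refine Matrix.ext_iff_mulVec.2 fun x => ?_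
  rw [Matrix.add_mulVec, ← Matrix.mulVec_mulVec, ← Matrix.mulVec_mulVec, incl_transpose_mulVec,
    incl_transpose_mulVec, Matrix.one_mulVec]
  ext i
  rw [Pi.add_apply]
  by_cases hi : i ∈ A
  · rw [incl_mulVec_mem _ hi, incl_mulVec_notMem _ (by simpa using hi), add_zero]
  · rw [incl_mulVec_notMem _ hi, incl_mulVec_mem _ (by simpa using hi), zero_add]

omit [Fintype ι] [DecidableEq ι] in
theorem posDef_sub {M : Matrix ι ι ℝ} (hM : M.PosDef) (A : Finset ι) : (sub M A A).PosDef :=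
  hM.submatrix Subtype.val_injective

omit [Fintype ι] in
theorem posDef_sigma1 {M : Matrix ι ι ℝ} (hM : M.PosDef) (S : Finset ι) : (sigma1 M S).PosDef :=
  (posDef_sub hM S).inv

omit [Fintype ι] in
theorem eq_incl_mulVec {S : Finset ι} {x : ι → ℝ} (hx : ∀ i, i ∉ S → x i = 0) :
    x = incl S *ᵥ fun i => x i := by
  ext i
  by_cases hi : i ∈ S
  · rw [incl_mulVec_mem _ hi]
  · rw [incl_mulVec_notMem _ hi, hx i hi]

/-- The covariance decomposition behind the splitting of the projection into the active and the
inactive coordinates. -/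
theorem mul_sigma_mul_eq {M : Matrix ι ι ℝ} (hM : M.PosDef) (S : Finset ι) :
    M * incl S * sigma1 M S * (M * incl S)ᵀ
      + incl Sᶜ * sigma2 M S * (incl Sᶜ)ᵀ = M := by
  have hMt : Mᵀ = M := by
    rw [← Matrix.conjTranspose_eq_transpose_of_trivial, hM.isHermitian.eq]
  have hU : IsUnit (sub M S S).det :=
    (Matrix.isUnit_iff_isUnit_det _).1 (posDef_sub hM S).isUnit
  have h1 : (incl S)ᵀ * M * incl S * sigma1 M S = 1 := by
    rw [← sub_eq_incl, sigma1, Matrix.mul_nonsing_inv _ hU]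
  have h2 : (incl S)ᵀ * incl Sᶜ = 0 := by
    rw [← Matrix.transpose_inj, Matrix.transpose_mul, Matrix.transpose_transpose,
      incl_compl_transpose_mul_incl, Matrix.transpose_zero]
  have h3 := incl_transpose_mul_incl Sᶜ
  have h4 := incl_mul_add_incl_compl_mul S
  set P := incl S
  set Q := incl Sᶜ
  set X := M * P * sigma1 M S * (M * P)ᵀ + Q * sigma2 M S * Qᵀ with hX
  -- As P Pᵀ + Q Qᵀ = 1, it suffices to compare the rows of X and M in S and in its complement
  -- separately.
  have hPX : Pᵀ * X = Pᵀ * M := by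
    rw [hX, Matrix.mul_add, ← Matrix.mul_assoc, ← Matrix.mul_assoc, ← Matrix.mul_assoc,
      ← Matrix.mul_assoc, ← Matrix.mul_assoc, h1, h2, Matrix.transpose_mul, hMt]
    simp
  have hQX : Qᵀ * X = Qᵀ * M := by
    have hs2 : sigma2 M S = Qᵀ * M * Q - Qᵀ * M * P * sigma1 M S * (Pᵀ * M * Q) := by
      rw [sigma2, sub_eq_incl M Sᶜ Sᶜ, sub_eq_incl M Sᶜ S, sigma1]
      simp only [Matrix.transpose_mul, Matrix.transpose_transpose, hMt, Matrix.mul_assoc]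
      rfl
    calc Qᵀ * X = Qᵀ * M * P * sigma1 M S * (Pᵀ * M) + (Qᵀ * Q) * sigma2 M S * Qᵀ := by
          rw [hX, Matrix.transpose_mul, hMt]; simp only [Matrix.mul_add, Matrix.mul_assoc]
      _ = Qᵀ * M * P * sigma1 M S * (Pᵀ * M) * (P * Pᵀ + Q * Qᵀ) + sigma2 M S * Qᵀ := by
          rw [h3, h4, Matrix.one_mul, Matrix.mul_one]
      -- The correction term of the Schur complement cancels the Q Qᵀ part of the first summand.
      _ = Qᵀ * M * P * (sigma1 M S * (Pᵀ * M * P)) * Pᵀ + Qᵀ * M * (Q * Qᵀ) := by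
          rw [hs2]
          simp only [Matrix.mul_add, Matrix.sub_mul, Matrix.mul_assoc]
          abel
      _ = Qᵀ * M := by
          rw [mul_eq_one_comm.1 h1, Matrix.mul_one, Matrix.mul_assoc (Qᵀ * M), ← Matrix.mul_add,
            h4, Matrix.mul_one]
  calc X = (P * Pᵀ + Q * Qᵀ) * X := by rw [h4, Matrix.one_mul]
    _ = (P * Pᵀ + Q * Qᵀ) * M := by
        rw [Matrix.add_mul, Matrix.add_mul, Matrix.mul_assoc, Matrix.mul_assoc, hPX, hQX,
          Matrix.mul_assoc, Matrix.mul_assoc]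
    _ = M := by rw [h4, Matrix.one_mul]

/-- Obtained from `mul_sigma_mul_eq` by multiplying by M⁻¹ on both sides. The left side is the
covariance of P a - M⁻¹ Q b. -/
theorem inv_eq_sigma {M : Matrix ι ι ℝ} (hM : M.PosDef) (S : Finset ι) :
    incl S * sigma1 M S * (incl S)ᵀ
      + (-(M⁻¹ * incl Sᶜ)) * sigma2 M S * (-(M⁻¹ * incl Sᶜ))ᵀ = M⁻¹ := by
  have hMt : Mᵀ = M := by
    rw [← Matrix.conjTranspose_eq_transpose_of_trivial, hM.isHermitian.eq]
  have hU : IsUnit M.det := (Matrix.isUnit_iff_isUnit_det _).1 hM.isUnit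
  have h := congrArg (fun X => M⁻¹ * X * M⁻¹) (mul_sigma_mul_eq hM S)
  rw [Matrix.nonsing_inv_mul _ hU, Matrix.one_mul] at h
  refine Eq.trans ?_ h
  simp only [Matrix.transpose_mul, Matrix.transpose_neg, hMt, Matrix.transpose_nonsing_inv,
    Matrix.mul_add, Matrix.add_mul, Matrix.neg_mul, Matrix.mul_neg, neg_neg, Matrix.mul_assoc,
    Matrix.mul_nonsing_inv _ hU, Matrix.mul_one]
  simp only [← Matrix.mul_assoc, Matrix.nonsing_inv_mul _ hU, Matrix.one_mul]

/-- The Schur complement is the inverse of the block of M⁻¹ indexed by the complement of S, and that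
block is positive definite. -/
theorem posDef_sigma2 {M : Matrix ι ι ℝ} (hM : M.PosDef) (S : Finset ι) :
    (sigma2 M S).PosDef := by
  have hU : IsUnit M.det := (Matrix.isUnit_iff_isUnit_det _).1 hM.isUnit
  have h := congrArg (fun X => (incl Sᶜ)ᵀ * (M⁻¹ * X) * incl Sᶜ) (mul_sigma_mul_eq hM S)
  have h0 : (incl Sᶜ)ᵀ * (M⁻¹ * (M * incl S * sigma1 M S * (M * incl S)ᵀ)) * incl Sᶜ = 0 := by
    simp only [← Matrix.mul_assoc, Matrix.nonsing_inv_mul_cancel_right _ _ hU,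
      incl_compl_transpose_mul_incl, Matrix.zero_mul]
  rw [Matrix.nonsing_inv_mul _ hU, Matrix.mul_one, incl_transpose_mul_incl, Matrix.mul_add,
    Matrix.mul_add, Matrix.add_mul, h0, zero_add, ← Matrix.mul_assoc, ← Matrix.mul_assoc,
    ← Matrix.mul_assoc, Matrix.mul_assoc _ (incl Sᶜ)ᵀ,
    incl_transpose_mul_incl, Matrix.mul_one, ← sub_eq_incl] at h
  rw [← Matrix.inv_eq_right_inv h]
  exact (posDef_sub hM.inv Sᶜ).inv

end Faces
end LocalOdds
namespace LocalOdds

/-! ### Probabilities of the projection faces -/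

section Weights

variable {ι : Type*} [Fintype ι] [DecidableEq ι]

/-- The points whose projection on the orthant has support `S`. -/
def projFace (M : Matrix ι ι ℝ) (S : Finset ι) : Set (EuclideanSpace ℝ ι) :=
  {z | ∃ ζ ∈ argmin M (orthant ι) z, ∀ i, 0 < ζ i ↔ i ∈ S}

/-- The point whose projection on the orthant has the positive part `a` and the multipliers `b`. -/
noncomputable def unproj (M : Matrix ι ι ℝ) (S : Finset ι)
    (x : EuclideanSpace ℝ S × EuclideanSpace ℝ (Sᶜ : Finset ι)) : EuclideanSpace ℝ ι :=
  Matrix.toEuclideanLin (incl S) x.1 + Matrix.toEuclideanLin (-(M⁻¹ * incl Sᶜ)) x.2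

/-- Half the gradient at a candidate supported in S; at y = a only Q b remains. -/
theorem mulVec_sub_unproj {M : Matrix ι ι ℝ} (hM : M.PosDef) (S : Finset ι) (y : S → ℝ)
    (x : EuclideanSpace ℝ S × EuclideanSpace ℝ (Sᶜ : Finset ι)) :
    M *ᵥ (incl S *ᵥ y - (unproj M S x).ofLp)
      = M *ᵥ (incl S *ᵥ (y - x.1.ofLp)) + incl Sᶜ *ᵥ x.2.ofLp := by
  have hU : IsUnit M.det := (Matrix.isUnit_iff_isUnit_det _).1 hM.isUnit
  rw [unproj, WithLp.ofLp_add, ofLp_toEuclideanLin, ofLp_toEuclideanLin, Matrix.neg_mulVec,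
    Matrix.mulVec_sub, Matrix.mulVec_add, Matrix.mulVec_neg, Matrix.mulVec_mulVec _ M,
    Matrix.mulVec_mulVec _ M, Matrix.mulVec_mulVec _ M, Matrix.mul_nonsing_inv_cancel_left _ _ hU,
    Matrix.mulVec_mulVec _ M, Matrix.mulVec_sub]
  abel

theorem unproj_mem_projFace_iff {M : Matrix ι ι ℝ} (hM : M.PosDef) (S : Finset ι)
    (x : EuclideanSpace ℝ S × EuclideanSpace ℝ (Sᶜ : Finset ι)) :
    unproj M S x ∈ projFace M S ↔
      (∀ i, 0 < x.1 i) ∧ x.2 ∈ orthant (Sᶜ : Finset ι) := by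
  constructor
  · rintro ⟨ζ, hζ, hS⟩
    obtain ⟨h0, hnn, hc⟩ := (mem_argmin_orthant_iff hM).1 hζ
    have hζS := eq_incl_mulVec (S := S) (x := ζ.ofLp) fun i hi =>
      le_antisymm (not_lt.1 fun h => hi ((hS i).1 h)) (h0 i)
    set y : S → ℝ := fun i => ζ i
    rw [hζS, mulVec_sub_unproj hM] at hnn hc
    -- Complementary slackness kills the gradient on S, leaving M(S, S)(y - a) = 0, so y = a.
    have h1 : (incl S)ᵀ *ᵥ (M *ᵥ (incl S *ᵥ (y - x.1.ofLp)) + incl Sᶜ *ᵥ x.2.ofLp) = 0 := by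
      rw [incl_transpose_mulVec]
      ext i
      exact hc i (hζS ▸ (hS i).2 i.2)
    have h2 : (incl S)ᵀ * incl Sᶜ = 0 := by
      rw [← Matrix.transpose_inj, Matrix.transpose_mul, Matrix.transpose_transpose,
        incl_compl_transpose_mul_incl, Matrix.transpose_zero]
    rw [Matrix.mulVec_add, Matrix.mulVec_mulVec, Matrix.mulVec_mulVec, Matrix.mulVec_mulVec, h2,
      Matrix.zero_mulVec, add_zero, ← sub_eq_incl] at h1
    have h3 : y - x.1.ofLp = 0 := Matrix.eq_zero_of_mulVec_eq_zero
      ((Matrix.isUnit_iff_isUnit_det _).1 (posDef_sub hM S).isUnit).ne_zero h1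
    rw [h3, Matrix.mulVec_zero, Matrix.mulVec_zero, zero_add] at hnn
    refine ⟨fun i => ?_, fun i => ?_⟩
    · rw [← sub_eq_zero.1 h3]
      exact (hS i).2 i.2
    · have := hnn i
      rwa [incl_mulVec_mem _ i.2] at this
  · rintro ⟨ha, hb⟩
    have hg : M *ᵥ (incl S *ᵥ x.1.ofLp - (unproj M S x).ofLp) = incl Sᶜ *ᵥ x.2.ofLp := by
      rw [mulVec_sub_unproj hM, sub_self, Matrix.mulVec_zero, Matrix.mulVec_zero, zero_add]
    have hS : ∀ i, 0 < (incl S *ᵥ x.1.ofLp) i ↔ i ∈ S := fun i => by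
      by_cases hi : i ∈ S
      · simpa [incl_mulVec_mem _ hi, hi] using ha ⟨i, hi⟩
      · simp [incl_mulVec_notMem _ hi, hi]
    refine ⟨Matrix.toEuclideanLin (incl S) x.1, (mem_argmin_orthant_iff hM).2 ⟨fun i => ?_, ?_⟩, hS⟩
    · rw [ofLp_toEuclideanLin]
      by_cases hi : i ∈ S
      · exact ((hS i).2 hi).le
      · rw [incl_mulVec_notMem _ hi]
    · rw [ofLp_toEuclideanLin, hg]
      refine ⟨fun i => ?_, fun i hi => incl_mulVec_notMem _ (by simpa using (hS i).1 hi)⟩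
      by_cases hi : i ∈ Sᶜ
      · rw [incl_mulVec_mem _ hi]
        exact hb _
      · rw [incl_mulVec_notMem _ hi]

/-- A right inverse of `unproj`. -/
theorem exists_unproj_eq {M : Matrix ι ι ℝ} (hM : M.PosDef) (S : Finset ι) :
    ∃ (A : Matrix S ι ℝ) (B : Matrix (Sᶜ : Finset ι) ι ℝ), ∀ z,
      unproj M S (Matrix.toEuclideanLin A z, Matrix.toEuclideanLin B z) = z := by
  have hU : IsUnit M.det := (Matrix.isUnit_iff_isUnit_det _).1 hM.isUnit
  have h1 : (incl S)ᵀ * M * incl S * sigma1 M S = 1 := by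
    rw [← sub_eq_incl, sigma1, Matrix.mul_nonsing_inv _
      ((Matrix.isUnit_iff_isUnit_det _).1 (posDef_sub hM S).isUnit)]
  have h4 : incl Sᶜ * (incl Sᶜ)ᵀ = 1 - incl S * (incl S)ᵀ :=
    eq_sub_of_add_eq' (incl_mul_add_incl_compl_mul S)
  -- Take a = Σ₁ Pᵀ M z, the unconstrained minimizer over vectors supported in S, and b = Qᵀ M (P a
  -- - z), its gradient off S. The normal equations `h5` say that the gradient vanishes on S.
  have key : incl S * (sigma1 M S * (incl S)ᵀ * M)
      + -(M⁻¹ * incl Sᶜ) * ((incl Sᶜ)ᵀ * M * (incl S * (sigma1 M S * (incl S)ᵀ * M) - 1)) = 1 := by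
    have h5 : (incl S)ᵀ * M * (incl S * (sigma1 M S * (incl S)ᵀ * M) - 1) = 0 := by
      rw [Matrix.mul_sub, ← Matrix.mul_assoc, ← Matrix.mul_assoc, ← Matrix.mul_assoc, h1]
      simp
    set X := incl S * (sigma1 M S * (incl S)ᵀ * M)
    have h6 : M⁻¹ * incl Sᶜ * ((incl Sᶜ)ᵀ * M * (X - 1)) = X - 1 := by
      calc M⁻¹ * incl Sᶜ * ((incl Sᶜ)ᵀ * M * (X - 1))
          = M⁻¹ * (incl Sᶜ * (incl Sᶜ)ᵀ) * (M * (X - 1)) := by simp only [Matrix.mul_assoc]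
        _ = M⁻¹ * (M * (X - 1)) - M⁻¹ * incl S * ((incl S)ᵀ * M * (X - 1)) := by
          rw [h4, Matrix.mul_sub M⁻¹, Matrix.sub_mul, Matrix.mul_one]
          simp only [Matrix.mul_assoc]
        _ = X - 1 := by
          rw [h5, Matrix.mul_zero, sub_zero, Matrix.nonsing_inv_mul_cancel_left _ _ hU]
    rw [Matrix.neg_mul, h6]
    abel
  refine ⟨sigma1 M S * (incl S)ᵀ * M,
    (incl Sᶜ)ᵀ * M * (incl S * (sigma1 M S * (incl S)ᵀ * M) - 1), fun z => ?_⟩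
  apply WithLp.ofLp_injective 2
  rw [unproj, WithLp.ofLp_add]
  simp only [ofLp_toEuclideanLin, Matrix.mulVec_mulVec]
  rw [← Matrix.add_mulVec, key, Matrix.one_mulVec]

theorem measurableSet_projFace {M : Matrix ι ι ℝ} (hM : M.PosDef) (S : Finset ι) :
    MeasurableSet (projFace M S) := by
  obtain ⟨A, B, hAB⟩ := exists_unproj_eq hM S
  have hA : Continuous (Matrix.toEuclideanLin A) := LinearMap.continuous_of_finiteDimensional _
  have hB : Continuous (Matrix.toEuclideanLin B) := LinearMap.continuous_of_finiteDimensional _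
  have h : projFace M S = (⋂ i, {z | 0 < (Matrix.toEuclideanLin A z) i})
      ∩ Matrix.toEuclideanLin B ⁻¹' orthant _ := by
    ext z
    conv_lhs => rw [← hAB z, unproj_mem_projFace_iff hM S]
    simp
  rw [h]
  exact (MeasurableSet.iInter fun i => measurableSet_lt measurable_const (by fun_prop)).inter
    (isClosed_orthant.measurableSet.preimage hB.measurable)

/-- N(0, M⁻¹) is the image under `unproj` of a product measure, and the preimage of the face is a
rectangle. -/
theorem multivariateGaussian_real_projFace {M : Matrix ι ι ℝ} (hM : M.PosDef) (S : Finset ι) :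
    (multivariateGaussian 0 M⁻¹).real (projFace M S)
      = (multivariateGaussian 0 (sigma1 M S)).real (orthant S)
        * (multivariateGaussian 0 (sigma2 M S)).real (orthant (Sᶜ : Finset ι)) := by
  have hmeas : Measurable (unproj M S) := by
    have hc1 : Continuous (Matrix.toEuclideanLin (incl S)) :=
      LinearMap.continuous_of_finiteDimensional _
    have hc2 : Continuous (Matrix.toEuclideanLin (-(M⁻¹ * incl Sᶜ))) :=
      LinearMap.continuous_of_finiteDimensional _
    unfold unproj
    fun_prop
  have hlaw := map_prod_multivariateGaussian (posDef_sigma1 hM S).posSemidef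
    (posDef_sigma2 hM S).posSemidef (incl S) (-(M⁻¹ * incl Sᶜ))
  rw [inv_eq_sigma hM S] at hlaw
  change Measure.map (unproj M S) _ = _ at hlaw
  have hpre : unproj M S ⁻¹' projFace M S = {a | ∀ i, 0 < a i} ×ˢ orthant _ := by
    ext x
    exact unproj_mem_projFace_iff hM S x
  rw [← hlaw, map_measureReal_apply hmeas (measurableSet_projFace hM S), hpre, measureReal_prod_prod, multivariateGaussian_real_orthant (posDef_sigma1 hM S)]

omit [DecidableEq ι] in
theorem setOf_argmin_mem_orthantFace (M : Matrix ι ι ℝ) (j : ℕ) :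
    {z | ∃ ζ ∈ argmin M (orthant ι) z, ζ ∈ orthantFace ι j}
      = ⋃ S ∈ (Finset.univ : Finset ι).powersetCard j, projFace M S := by
  ext z
  simp only [Set.mem_ofPred_eq, Set.mem_iUnion, Finset.mem_powersetCard_univ, projFace,
    exists_prop]
  constructor
  · rintro ⟨ζ, hζ, -, hcard⟩
    refine ⟨Finset.univ.filter fun i => 0 < ζ i, ?_, ζ, hζ, by simp⟩
    rw [← hcard, Nat.card_eq_fintype_card, Fintype.card_subtype]
  · rintro ⟨S, hS, ζ, hζ, h⟩
    refine ⟨ζ, hζ, hζ.1, ?_⟩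
    simp [h, ← hS]

theorem measurableSet_argmin_mem_orthantFace {M : Matrix ι ι ℝ} (hM : M.PosDef) (j : ℕ) :
    MeasurableSet {z | ∃ ζ ∈ argmin M (orthant ι) z, ζ ∈ orthantFace ι j} := by
  rw [setOf_argmin_mem_orthantFace]
  exact Finset.measurableSet_biUnion _ fun S _ => measurableSet_projFace hM S

/-- The weights of the projection of a Gaussian vector on the orthant. -/
theorem multivariateGaussian_real_argmin_mem_orthantFace {M : Matrix ι ι ℝ} (hM : M.PosDef)
    (j : ℕ) :
    (multivariateGaussian 0 M⁻¹).real {z | ∃ ζ ∈ argmin M (orthant ι) z, ζ ∈ orthantFace ι j}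
      = ∑ S ∈ (Finset.univ : Finset ι).powersetCard j,
        (multivariateGaussian 0 (sigma1 M S)).real (orthant S)
          * (multivariateGaussian 0 (sigma2 M S)).real (orthant (Sᶜ : Finset ι)) := by
  rw [setOf_argmin_mem_orthantFace, measureReal_biUnion_finset]
  · exact Finset.sum_congr rfl fun S _ => multivariateGaussian_real_projFace hM S
  -- Uniqueness of the projection determines its support, so faces for distinct S are disjoint.
  · intro S _ S' _ hne
    refine Set.disjoint_left.2 ?_
    rintro z ⟨ζ, hζ, h⟩ ⟨ξ, hξ, h'⟩
    refine hne (Finset.ext fun i => ?_)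
    rw [← h, ← h', argmin_orthant_unique hM hζ hξ]
  · exact fun S _ => measurableSet_projFace hM S

end Weights

end LocalOdds

theorem corollary3 {r c : ℕ}
    (ν : Fin (r + 1) → ℝ) (hν_pos : ∀ i, 0 < ν i) (hν_sum : ∑ i, ν i = 1)
    (θ₀ : LocalOdds.Param r c) (hθ₀ : LocalOdds.IsNull θ₀)
    {Ω : Type*} [MeasurableSpace Ω] (P : Measure Ω) [IsProbabilityMeasure P]
    (Z : Ω → EuclideanSpace ℝ (Fin r × Fin c))
    (hZ : HasLaw Z (multivariateGaussian 0 (LocalOdds.H ν θ₀)⁻¹) P) :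
    -- the weights of the asymptotic distribution are those of the projection on the orthant
    (∀ j : ℕ,
      LocalOdds.testWeight ν θ₀ j
          = LocalOdds.chiBarWeight (LocalOdds.H ν θ₀)⁻¹ (LocalOdds.orthant (Fin r × Fin c)) j ∧
      LocalOdds.testWeight ν θ₀ j
          = P.real {ω | ∃ ζ ∈ LocalOdds.argmin (LocalOdds.H ν θ₀)
                (LocalOdds.orthant (Fin r × Fin c)) (Z ω),
              ζ ∈ LocalOdds.orthantFace (Fin r × Fin c) j}) ∧
    -- the minimizer exists and is unique, and the covariance matrix is a genuine inverse
    (∀ z : EuclideanSpace ℝ (Fin r × Fin c),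
      ∃! ζ, ζ ∈ LocalOdds.argmin (LocalOdds.H ν θ₀) (LocalOdds.orthant (Fin r × Fin c)) z) ∧
    (LocalOdds.H ν θ₀).PosDef ∧
    -- the explicit inverses
    (LocalOdds.H ν θ₀)⁻¹
        = (LocalOdds.K ν)⁻¹ ⊗ₖ (LocalOdds.K (LocalOdds.commonProb θ₀))⁻¹ ∧
    (∀ (k : ℕ) (q : Fin (k + 1) → ℝ), (∀ i, 0 < q i) → ∑ i, q i = 1 →
      IsUnit (LocalOdds.K q).det ∧
      (LocalOdds.K q)⁻¹
        = (LocalOdds.T k)ᵀ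
          * (Matrix.diagonal (LocalOdds.dropLast q)
              - Matrix.vecMulVec (LocalOdds.dropLast q) (LocalOdds.dropLast q))
          * LocalOdds.T k) ∧
    (∀ h : ℕ, IsUnit (LocalOdds.G h).det ∧ LocalOdds.T h = (LocalOdds.G h)⁻¹) := by
  have hH := LocalOdds.posDef_H hν_pos θ₀
  have hw := LocalOdds.multivariateGaussian_real_argmin_mem_orthantFace hH
  refine ⟨fun j => ⟨?_, ?_⟩, fun z => ?_, hH, Matrix.inv_kronecker _ _,
    fun k q hq hs => ⟨LocalOdds.isUnit_det_K hq hs, LocalOdds.K_inv hq hs⟩,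
    fun h => ⟨LocalOdds.isUnit_det_G h, LocalOdds.T_eq_inv_G h⟩⟩
  -- The projection is taken in the metric of V⁻¹ with V = H⁻¹, that is, of H itself.
  · rw [LocalOdds.chiBarWeight, Matrix.nonsing_inv_nonsing_inv _
      ((Matrix.isUnit_iff_isUnit_det _).1 hH.isUnit), hw j]
    rfl
  · rw [hZ.measureReal_eq (LocalOdds.measurableSet_argmin_mem_orthantFace hH j), hw j]
    rfl
  · obtain ⟨ζ, hζ⟩ := LocalOdds.exists_mem_argmin_orthant hH z
    exact ⟨ζ, hζ, fun ξ hξ => LocalOdds.argmin_orthant_unique hH hζ hξ⟩
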